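/- A \emph{ballean} is a set $X$ with a family $\mathcal E_X$ of reflexive symmetric relations on $X$ (called radii) such that $\bigcup\mathcal E_X=X\times X$ and for all $\varepsilon,\delta\in\mathcal E_X$ the composition $\varepsilon\circ\delta$ is contained in some $\eta\in\mathcal E_X$. A subset $A\subset X$ carries the ballean structure $\{\varepsilon\cap A^2:\varepsilon\in\mathcal E_X\}$. A subset $L\subset X$ is \emph{large} if for some $\varepsilon\in\mathcal E_X$ every $x\in X$ satisfies $(a,x)\in\varepsilon$ for some $a\in L$. A map $f:X\to Y$ of balleans is \emph{coarse} if for each $\varepsilon\in\mathcal E_X$ there is $\delta\in\mathcal E_Y$ with $\{(f(x),f(y)):(x,y)\in\varepsilon\}\subset\delta$; a \emph{coarse isomorphism} is a bijection $f$ such that $f$ and $f^{-1}$ are coarse. Two balleans are \emph{coarsely equivalent} if they contain large subsets that are coarsely isomorphic. For a nonzero ordinal $\gamma$, the Cantor macro-cube $2^{<\gamma}$ is the set of all $x\in\{0,1\}^{\gamma}$ for which $\{\alpha<\gamma:x_\alpha\neq0\}$ is finite, with the ballean structure $\{\varepsilon_\beta\}_{\beta<\gamma}$, where $\varepsilon_\beta=\{(x,y):x_\alpha=y_\alpha\text{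 for all }\alpha\text{ with }\beta<\alpha<\gamma\}$. Let $\mathrm{cf}(\gamma)$ denote the cofinality of $\gamma$, and let $$\lceil\gamma\rceil=\min\{\alpha:\gamma\le\beta+|\alpha|\text{ for some }\beta<\gamma\}$$ be its cardinal tail, where the cardinal $|\alpha|$ is regarded as an initial ordinal and $+$ is ordinal addition. \textbf{Corollary.} For any two nonzero ordinals $\beta,\gamma$, the Cantor macro-cubes $2^{<\beta}$ and $2^{<\gamma}$ are coarsely equivalent if and only if $\mathrm{cf}(\beta)=\mathrm{cf}(\gamma)$ and $\lceil\beta\rceil=\lceil\gamma\rceil$. -/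

import Mathlib

universe u v

/-- An entourage on `X`: a reflexive symmetric relation, as a subset of `X × X`. -/
structure IsEntourage {X : Type u} (ε : Set (X × X)) : Prop where
  refl : ∀ x, (x, x) ∈ ε
  symm : ∀ x y, (x, y) ∈ ε → (y, x) ∈ ε

/-- The composition `ε ∘ δ` of two relations on `X`. -/
def entComp {X : Type u} (ε δ : Set (X × X)) : Set (X × X) :=
  {p | ∃ y, (p.1, y) ∈ ε ∧ (y, p.2) ∈ δ}

/-- A ballean structure on `X`: a family of entourages (the set of radii) covering `X × X` such
that the composition of any two of them is contained in a third. -/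
structure Ballean (X : Type u) where
  radii : Set (Set (X × X))
  isEntourage : ∀ ε ∈ radii, IsEntourage ε
  sUnion_radii : ⋃₀ radii = Set.univ
  exists_comp_subset : ∀ ε ∈ radii, ∀ δ ∈ radii, ∃ η ∈ radii, entComp ε δ ⊆ η

namespace Ballean

variable {X : Type u} {Y : Type v}

/-- The subballean on `A ⊆ X`, with radii the traces of the radii of `X` on `A`. -/
def sub (E : Ballean X) (A : Set X) : Ballean A where
  radii := {δ | ∃ ε ∈ E.radii, δ = {p : A × A | ((p.1 : X), (p.2 : X)) ∈ ε}}
  isEntourage := by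
    rintro _ ⟨ε, hε, rfl⟩
    exact ⟨fun x => (E.isEntourage ε hε).refl x, fun x y h => (E.isEntourage ε hε).symm x y h⟩
  sUnion_radii := by
    refine Set.eq_univ_of_forall fun p => ?_
    have h : ((p.1 : X), (p.2 : X)) ∈ ⋃₀ E.radii := by rw [E.sUnion_radii]; trivial
    obtain ⟨ε, hε, hp⟩ := h
    exact ⟨_, ⟨ε, hε, rfl⟩, hp⟩
  exists_comp_subset := by
    rintro _ ⟨ε, hε, rfl⟩ _ ⟨δ, hδ, rfl⟩
    obtain ⟨η, hη, h⟩ := E.exists_comp_subset ε hε δ hδ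
    refine ⟨_, ⟨η, hη, rfl⟩, ?_⟩
    rintro p ⟨y, h₁, h₂⟩
    exact h ⟨y, h₁, h₂⟩

/-- A map between balleans is coarse if the image of every radius is contained in a radius. -/
def IsCoarse (E : Ballean X) (F : Ballean Y) (f : X → Y) : Prop :=
  ∀ ε ∈ E.radii, ∃ δ ∈ F.radii, ∀ x y, (x, y) ∈ ε → (f x, f y) ∈ δ

/-- Coarsely isomorphic balleans: there is a bijection that is coarse in both directions. -/
def CoarselyIsomorphic (E : Ballean X) (F : Ballean Y) : Prop :=
  ∃ f : X ≃ Y, IsCoarse E F f ∧ IsCoarse F E f.symm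

/-- `L` is large if `X` is the `ε`-neighbourhood of `L` for some radius `ε`. -/
def IsLarge (E : Ballean X) (L : Set X) : Prop :=
  ∃ ε ∈ E.radii, ∀ x, ∃ a ∈ L, (a, x) ∈ ε

/-- Coarsely equivalent balleans: they contain coarsely isomorphic large subballeans. -/
def CoarselyEquivalent (E : Ballean X) (F : Ballean Y) : Prop :=
  ∃ (L : Set X) (M : Set Y), E.IsLarge L ∧ F.IsLarge M ∧
    CoarselyIsomorphic (E.sub L) (F.sub M)

end Ballean

/-- The underlying set of `2^{<γ}`: finitely supported `0`-`1` sequences indexed by the ordinals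
`α < γ`. -/
def MacroCube (γ : Ordinal.{u}) : Type (u + 1) :=
  {x : Set.Iio γ → Fin 2 // {α | x α ≠ 0}.Finite}

/-- The entourage of `2^{<γ}` with index `β`: sequences that agree at all coordinates `α > β`. -/
def macroCubeEntourage {γ : Ordinal.{u}} (β : Set.Iio γ) : Set (MacroCube γ × MacroCube γ) :=
  {p | ∀ α : Set.Iio γ, β < α → p.1.1 α = p.2.1 α}

/-- The ballean `2^{<γ}` for a nonzero ordinal `γ`. -/
def cantorMacroCube (γ : Ordinal.{u}) (hγ : γ ≠ 0) : Ballean (MacroCube γ) where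
  radii := Set.range macroCubeEntourage
  isEntourage := by
    rintro _ ⟨β, rfl⟩
    exact ⟨fun x α _ => rfl, fun x y h α hα => (h α hα).symm⟩
  sUnion_radii := by
    refine Set.eq_univ_of_forall fun p => ?_
    have hne : Nonempty (Set.Iio γ) := ⟨⟨0, pos_iff_ne_zero.mpr hγ⟩⟩
    obtain ⟨β, hβ⟩ := (p.1.2.union p.2.2).bddAbove
    refine ⟨_, ⟨β, rfl⟩, fun α hα => ?_⟩
    have h : α ∉ {α | p.1.1 α ≠ 0} ∪ {α | p.2.1 α ≠ 0} := fun h => absurd (hβ h) (not_le.mpr hα)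
    simp only [Set.mem_union, Set.mem_ofPred_eq, not_or, not_not] at h
    rw [h.1, h.2]
  exists_comp_subset := by
    rintro _ ⟨β, rfl⟩ _ ⟨δ, rfl⟩
    refine ⟨_, ⟨max β δ, rfl⟩, ?_⟩
    rintro p ⟨y, h₁, h₂⟩ α hα
    exact (h₁ α ((le_max_left _ _).trans_lt hα)).trans (h₂ α ((le_max_right _ _).trans_lt hα))

/-- The cardinal tail `⌈γ⌉ = min {α : γ ≤ β + |α| for some β < γ}` of an ordinal `γ`, where
cardinals are regarded as initial ordinals. -/
noncomputable def cardinalTail (γ : Ordinal.{u}) : Ordinal.{u} :=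
  sInf {α | ∃ β < γ, γ ≤ β + α.card.ord}

/-! A coarse equivalence yields a map `F` that preserves and reflects closeness and has large image.
Testing `F` on points with one nonzero coordinate shows that cofinality cannot grow
(`IsCoarseEquiv.cof_le`). Counting points that lie within one scale but are separated at another
reduces to counting finite subsets of an interval of coordinates, so an infinite bound on the tail
carries over (`IsCoarseEquiv.exists_le_add_ord`).

Conversely, only boundedness of sets of coordinates matters, not their order: a bijection of final
segments preserving boundedness both ways suffices. If the common tail `k` is not the successor of
an infinite cardinal, both ordinals end in a copy of `k.ord`. If `k = succ c`, both have final
segments split into cofinality many blocks of size `c`, which are matched block by block. -/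

open Set Cardinal

/-! ### Invariants of coarse equivalence. -/

namespace MacroCube

variable {β γ : Ordinal.{u}}

/-- Two points of a macro-cube agree at all coordinates above `a`. -/
def Close (a : Iio γ) (x y : MacroCube γ) : Prop := (x, y) ∈ macroCubeEntourage a

theorem Close.refl (a : Iio γ) (x : MacroCube γ) : Close a x x := fun _ _ => rfl

theorem Close.symm {a : Iio γ} {x y : MacroCube γ} (h : Close a x y) : Close a y x :=
  fun α hα => (h α hα).symm

theorem Close.mono {a b : Iio γ} (hab : a ≤ b) {x y : MacroCube γ} (h : Close a x y) :
    Close b x y :=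
  fun α hα => h α (hab.trans_lt hα)

theorem Close.trans {a : Iio γ} {x y z : MacroCube γ} (h : Close a x y) (h' : Close a y z) :
    Close a x z :=
  fun α hα => (h α hα).trans (h' α hα)

/-- The point of the macro-cube with a single nonzero coordinate `d`. -/
noncomputable def single (d : Iio γ) : MacroCube γ :=
  ⟨fun α => open Classical in if α = d then 1 else 0,
    (finite_singleton d).subset fun α hα => by by_contra h; simp_all⟩

theorem single_self (d : Iio γ) : (single d).1 d = 1 := if_pos rfl

theorem single_of_ne {d α : Iio γ} (h : α ≠ d) : (single d).1 α = 0 := if_neg h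

theorem close_single_iff {a d d' : Iio γ} (hd : a < d) :
    Close a (single d) (single d') ↔ d = d' := by
  refine ⟨fun h => ?_, fun h => h ▸ Close.refl _ _⟩
  by_contra hne
  have := h d hd
  simp [single_self, single_of_ne hne] at this

theorem close_single {a d d' : Iio γ} (hd : d ≤ a) (hd' : d' ≤ a) :
    Close a (single d) (single d') :=
  fun _ hα => (single_of_ne (hd.trans_lt hα).ne').trans (single_of_ne (hd'.trans_lt hα).ne').symm

/-- A map of macro-cubes is a coarse equivalence if it is coarse, reflects closeness and has
large image. -/
structure IsCoarseEquiv (F : MacroCube β → MacroCube γ) : Prop where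
  map : ∀ a, ∃ c, ∀ x x', Close a x x' → Close c (F x) (F x')
  reflect : ∀ c, ∃ a, ∀ x x', Close c (F x) (F x') → Close a x x'
  large : ∃ m, ∀ y, ∃ x, Close m (F x) y

/-- Moving each point to a nearby point of `L` before applying `f` gives a map on the whole cube, at
the cost of enlarging scales. -/
theorem exists_isCoarseEquiv {hβ : β ≠ 0} {hγ : γ ≠ 0}
    (h : Ballean.CoarselyEquivalent (cantorMacroCube β hβ) (cantorMacroCube γ hγ)) :
    ∃ F : MacroCube β → MacroCube γ, IsCoarseEquiv F := by
  obtain ⟨L, M, ⟨_, ⟨l, rfl⟩, hL⟩, ⟨_, ⟨m, rfl⟩, hM⟩, f, hf, hf'⟩ := h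
  have map : ∀ a : Iio β, ∃ c : Iio γ, ∀ x y : L, Close a x.1 y.1 → Close c (f x).1 (f y).1 := by
    intro a
    obtain ⟨_, ⟨_, ⟨c, rfl⟩, rfl⟩, h⟩ := hf _ ⟨_, ⟨a, rfl⟩, rfl⟩
    exact ⟨c, h⟩
  have refl : ∀ c : Iio γ, ∃ a : Iio β, ∀ x y : L, Close c (f x).1 (f y).1 → Close a x.1 y.1 := by
    intro c
    obtain ⟨_, ⟨_, ⟨a, rfl⟩, rfl⟩, h⟩ := hf' _ ⟨_, ⟨c, rfl⟩, rfl⟩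
    refine ⟨a, fun x y hxy => ?_⟩
    have := h (f x) (f y) hxy
    rwa [f.symm_apply_apply, f.symm_apply_apply] at this
  choose p hp hpx using hL
  replace hpx : ∀ x, Close l (p x) x := hpx
  refine ⟨fun x => (f ⟨p x, hp x⟩).1, fun a => ?_, fun c => ?_, ?_⟩
  · obtain ⟨c, hc⟩ := map (max a l)
    exact ⟨c, fun x x' h => hc _ _ <| ((hpx x).mono (le_max_right _ _)).trans <|
      (h.mono (le_max_left _ _)).trans ((hpx x').symm.mono (le_max_right _ _))⟩
  · obtain ⟨a, ha⟩ := refl c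
    exact ⟨max a l, fun x x' h => ((hpx x).symm.mono (le_max_right _ _)).trans <|
      ((ha _ _ h).mono (le_max_left _ _)).trans ((hpx x').mono (le_max_right _ _))⟩
  · obtain ⟨c, hc⟩ := map l
    refine ⟨max c m, fun y => ?_⟩
    obtain ⟨w, hw, hwy⟩ := hM y
    refine ⟨(f.symm ⟨w, hw⟩).1, ?_⟩
    have h1 := hc ⟨_, hp _⟩ (f.symm ⟨w, hw⟩) (hpx _)
    rw [f.apply_symm_apply] at h1
    exact (h1.mono (le_max_left _ _)).trans (Close.mono (le_max_right _ _) hwy)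

theorem IsCoarseEquiv.cof_le {F : MacroCube β → MacroCube γ} (hF : IsCoarseEquiv F) :
    γ.cof ≤ β.cof := by
  suffices h : Order.cof (Iio γ) ≤ Order.cof (Iio β) by
    rwa [Ordinal.cof_Iio, Ordinal.cof_Iio, ← Ordinal.lift_cof, ← Ordinal.lift_cof, lift_le] at h
  obtain ⟨S, hS, hcard⟩ := Order.exists_cof_eq (Iio β)
  choose c hc using hF.map
  obtain ⟨m, hm⟩ := hF.large
  rw [← hcard]
  refine le_trans (Order.cof_le (s := range fun a : S => max (c a) m) fun d => ?_) mk_range_le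
  obtain ⟨a, ha⟩ := hF.reflect (max d m)
  obtain ⟨s, hs, has⟩ := hS a
  refine ⟨_, ⟨⟨s, hs⟩, rfl⟩, ?_⟩
  -- Preimages of `single d` and `single m` are `a`-close, hence `s`-close, so their images are `c
  -- s`-close. With `d` above `max (c s) m` this forces `d = m`.
  by_contra! hlt
  obtain ⟨h1, h2⟩ := max_lt_iff.1 hlt
  obtain ⟨x, hx⟩ := hm (single d)
  obtain ⟨x', hx'⟩ := hm (single m)
  have h3 : Close (max d m) (F x) (F x') := (hx.mono (le_max_right _ _)).trans <|
    (close_single (le_max_left _ _) (le_max_right _ _)).trans (hx'.symm.mono (le_max_right _ _))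
  have h4 := hc s _ _ ((ha _ _ h3).mono has)
  have h5 : Close (max (c s) m) (single d) (single m) := (hx.symm.mono (le_max_right _ _)).trans <|
    (h4.mono (le_max_left _ _)).trans (hx'.mono (le_max_right _ _))
  exact h2.ne' ((close_single_iff hlt).1 h5)

/-- Points of a macro-cube that are close at scale `a` but pairwise not close at scale `b` are
determined by their supports in the interval `(b, a]`. -/
theorem exists_injective_finset_Ioc {ι : Type*} {a b : Iio β} (x : ι → MacroCube β)
    (ha : ∀ i j, Close a (x i) (x j)) (hb : ∀ i j, Close b (x i) (x j) → i = j) :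
    ∃ f : ι → Finset (Ioc b a), Function.Injective f := by
  have hfin : ∀ i, {α : Ioc b a | (x i).1 α.1 ≠ 0}.Finite := fun i =>
    (x i).2.preimage Subtype.val_injective.injOn
  refine ⟨fun i => (hfin i).toFinset, fun i j hij => hb i j fun α hα => ?_⟩
  by_cases h : α ≤ a
  · have := Set.ext_iff.1 (Finite.toFinset_inj.1 hij) ⟨α, hα, h⟩
    simp only [mem_ofPred_eq] at this
    generalize (x i).1 α = p at *
    generalize (x j).1 α = q at *
    revert p q
    decide
  · exact ha i j α (not_le.1 h)

theorem mk_finset_lt {α : Type*} {c : Cardinal} (hc : ℵ₀ ≤ c) (h : #α < c) : #(Finset α) < c := by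
  cases finite_or_infinite α
  · exact (lt_aleph0_of_finite _).trans_le hc
  · rwa [mk_finset_of_infinite]

/-- Otherwise `c` many single-coordinate points lie within one scale and are separated at scale `e`.
Their approximate preimages lie within scale `a` and are separated at scale `b`, but `(b, a]` has
fewer than `c` coordinates, hence fewer than `c` finite subsets. -/
theorem IsCoarseEquiv.exists_le_add_ord {F : MacroCube β → MacroCube γ} (hF : IsCoarseEquiv F)
    {c : Cardinal.{u}} (hc : ℵ₀ ≤ c) (h : ∃ b < β, β ≤ b + c.ord) :
    ∃ b < γ, γ ≤ b + c.ord := by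
  obtain ⟨b, hb, hβ⟩ := h
  obtain ⟨d, hd⟩ := hF.map ⟨b, hb⟩
  obtain ⟨m, hm⟩ := hF.large
  set e := max d m
  refine ⟨e, e.2, ?_⟩
  by_contra! hlt
  have hlim : Order.IsSuccLimit c.ord := isSuccLimit_ord hc
  have hy : ∀ i : Iio c.ord, e.1 + (i + 1) < e + c.ord := fun i =>
    (add_lt_add_iff_left _).2 (hlim.add_one_lt i.2)
  -- The shift by one puts every coordinate strictly above `e`, as `close_single_iff` requires.
  let y : Iio c.ord → Iio γ := fun i => ⟨e + (i + 1), (hy i).trans hlt⟩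
  choose x hx using fun i => hm (single (y i))
  obtain ⟨a, ha⟩ := hF.reflect (max ⟨_, hlt⟩ m)
  obtain ⟨f, hf⟩ := exists_injective_finset_Ioc (a := a) (b := ⟨b, hb⟩) x
    (fun i j => ha _ _ <| ((hx i).mono (le_max_right _ _)).trans <|
      (close_single (le_max_of_le_left (hy i).le) (le_max_of_le_left (hy j).le)).trans
        ((hx j).symm.mono (le_max_right _ _)))
    (fun i j hij => by
      have h1 : Close e (single (y i)) (single (y j)) :=
        ((hx i).symm.mono (le_max_right _ _)).trans <|
          ((hd _ _ hij).mono (le_max_left _ _)).trans ((hx j).mono (le_max_right _ _))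
      have h2 : e < y i := by
        change e.1 < e.1 + (i + 1)
        rw [← add_assoc]
        exact Order.lt_add_one_iff.2 le_self_add
      have h3 := congrArg Subtype.val ((close_single_iff h2).1 h1)
      simpa [y, Subtype.ext_iff] using h3)
  have hcard : #(Ioc (⟨b, hb⟩ : Iio β) a) < Cardinal.lift.{u + 1} c := by
    have hab : a.1 - b < c.ord :=
      Ordinal.sub_lt_of_lt_add (a.2.trans_le hβ) hlim.bot_lt
    let g : Ioc (⟨b, hb⟩ : Iio β) a → Iio (a.1 - b + 1) := fun ξ =>
      ⟨ξ.1.1 - b, Order.lt_add_one_iff.2 (Ordinal.sub_le.2 <|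
        (show ξ.1.1 ≤ a from ξ.2.2).trans (Ordinal.le_add_sub _ _))⟩
    have hg : Function.Injective g := fun ξ η h => by
      have h1 : ξ.1.1 - b = η.1.1 - b := congrArg Subtype.val h
      have h2 := Ordinal.add_sub_cancel_of_le (show b ≤ ξ.1.1 from ξ.2.1.le)
      rw [h1, Ordinal.add_sub_cancel_of_le (show b ≤ η.1.1 from η.2.1.le)] at h2
      exact Subtype.ext (Subtype.ext h2.symm)
    refine (mk_le_of_injective hg).trans_lt ?_
    rw [mk_Iio_ordinal, lift_lt, ← lt_ord]
    exact hlim.add_one_lt hab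
  have := (mk_le_of_injective hf).trans_lt (mk_finset_lt (by simpa using hc) hcard)
  rw [mk_Iio_ordinal, card_ord] at this
  exact lt_irrefl _ this

/-! ### Coarse equivalences from bijections of coordinates. -/

section Transport

variable {b : Iio β} {c : Iio γ}

/-- Transport of a point along a bijection between final segments of the coordinates, with zeros
at the remaining coordinates. -/
noncomputable def transport (e : Ici b ≃ Ici c) (x : MacroCube β) : MacroCube γ :=
  ⟨fun α => open Classical in if h : c ≤ α then x.1 (e.symm ⟨α, h⟩) else 0, by
    refine ((x.2.preimage (f := fun ξ : Ici b => ξ.1) Subtype.val_injective.injOn).image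
      fun ξ => (e ξ).1).subset fun α hα => ?_
    have h : c ≤ α := by
      by_contra h
      exact hα (dif_neg h)
    refine ⟨e.symm ⟨α, h⟩, ?_, by simp⟩
    simpa [h] using hα⟩

theorem transport_apply (e : Ici b ≃ Ici c) (x : MacroCube β) (ξ : Ici c) :
    (transport e x).1 ξ = x.1 (e.symm ξ) := dif_pos ξ.2

theorem transport_apply_of_lt (e : Ici b ≃ Ici c) (x : MacroCube β) {α : Iio γ} (h : α < c) :
    (transport e x).1 α = 0 := dif_neg h.not_ge

/-- The points of a macro-cube supported at coordinates `≥ b`. -/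
def supportedGe (b : Iio β) : Set (MacroCube β) := {x | ∀ α < b, x.1 α = 0}

theorem isLarge_supportedGe (hβ : β ≠ 0) (b : Iio β) :
    (cantorMacroCube β hβ).IsLarge (supportedGe b) := by
  classical
  refine ⟨_, ⟨b, rfl⟩, fun x => ⟨⟨fun α => if α < b then 0 else x.1 α, ?_⟩, ?_, ?_⟩⟩
  · exact x.2.subset fun α hα => by
      intro h
      simp [h] at hα
  · intro α hα
    exact if_pos hα
  · intro α hα
    exact if_neg hα.not_gt

theorem transport_mem (e : Ici b ≃ Ici c) (x : MacroCube β) : transport e x ∈ supportedGe c :=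
  fun _ h => transport_apply_of_lt e x h

theorem transport_symm_transport (e : Ici b ≃ Ici c) {x : MacroCube β} (hx : x ∈ supportedGe b) :
    transport e.symm (transport e x) = x := by
  refine Subtype.ext (funext fun α => ?_)
  obtain h | h := lt_or_ge α b
  · rw [hx α h, transport_apply_of_lt _ _ h]
  · have h1 := transport_apply e.symm (transport e x) ⟨α, h⟩
    have h2 := transport_apply e x (e ⟨α, h⟩)
    rw [e.symm_apply_apply] at h2
    exact h1.trans h2

theorem Close.transport (e : Ici b ≃ Ici c) {a : Iio β} {a' : Iio γ}
    (h : ∀ ξ : Ici b, ξ.1 ≤ a → (e ξ).1 ≤ a') {x y : MacroCube β} (hxy : Close a x y) :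
    Close a' (transport e x) (transport e y) := by
  intro α hα
  obtain hc | hc := lt_or_ge α c
  · exact (transport_apply_of_lt e x hc).trans (transport_apply_of_lt e y hc).symm
  · have h1 := transport_apply e x ⟨α, hc⟩
    have h2 := transport_apply e y ⟨α, hc⟩
    refine h1.trans (Eq.trans ?_ h2.symm)
    refine hxy _ (not_le.1 fun hle => ?_)
    have := h _ hle
    rw [e.apply_symm_apply] at this
    exact this.not_gt hα

/-- A bijection between final segments of the coordinates that preserves boundedness in both
directions yields a coarse equivalence of macro-cubes. -/
theorem coarselyEquivalent_of_equiv (hβ : β ≠ 0) (hγ : γ ≠ 0) (e : Ici b ≃ Ici c)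
    (h : ∀ a : Iio β, ∃ a' : Iio γ, ∀ ξ : Ici b, ξ.1 ≤ a → (e ξ).1 ≤ a')
    (h' : ∀ a : Iio γ, ∃ a' : Iio β, ∀ ξ : Ici c, ξ.1 ≤ a → (e.symm ξ).1 ≤ a') :
    Ballean.CoarselyEquivalent (cantorMacroCube β hβ) (cantorMacroCube γ hγ) := by
  refine ⟨supportedGe b, supportedGe c, isLarge_supportedGe hβ b, isLarge_supportedGe hγ c,
    ⟨fun x => ⟨transport e x, transport_mem e x⟩,
      fun y => ⟨transport e.symm y, transport_mem e.symm y⟩,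
      fun x => Subtype.ext (transport_symm_transport e x.2),
      fun y => Subtype.ext (transport_symm_transport e.symm y.2)⟩, ?_, ?_⟩
  · rintro _ ⟨_, ⟨a, rfl⟩, rfl⟩
    obtain ⟨a', ha'⟩ := h a
    exact ⟨_, ⟨_, ⟨a', rfl⟩, rfl⟩, fun x y hxy => Close.transport e ha' hxy⟩
  · rintro _ ⟨_, ⟨a, rfl⟩, rfl⟩
    obtain ⟨a', ha'⟩ := h' a
    exact ⟨_, ⟨_, ⟨a', rfl⟩, rfl⟩, fun x y hxy => Close.transport e.symm ha' hxy⟩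

end Transport

/-- Macro-cubes over `b + δ` and `c + δ` are coarsely equivalent. -/
theorem coarselyEquivalent_of_eq_add (hβ : β ≠ 0) (hγ : γ ≠ 0) {b c δ : Ordinal.{u}} (hδ : δ ≠ 0)
    (hb : β = b + δ) (hc : γ = c + δ) :
    Ballean.CoarselyEquivalent (cantorMacroCube β hβ) (cantorMacroCube γ hγ) := by
  have hδ' : 0 < δ := pos_iff_ne_zero.2 hδ
  have key : ∀ {β γ b c : Ordinal.{u}}, β = b + δ → γ = c + δ → ∀ a : Iio β, c + (a - b) < γ := by
    rintro β γ b c rfl rfl a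
    exact (add_lt_add_iff_left _).2 (Ordinal.sub_lt_of_lt_add a.2 hδ')
  have sub_mono : ∀ {x y : Ordinal.{u}} (b : Ordinal.{u}), x ≤ y → x - b ≤ y - b := fun b h =>
    Ordinal.sub_le.2 (h.trans (Ordinal.le_add_sub _ _))
  have hb' : b < β := by rw [hb]; simpa using hδ'
  have hc' : c < γ := by rw [hc]; simpa using hδ'
  refine coarselyEquivalent_of_equiv (b := ⟨b, hb'⟩) (c := ⟨c, hc'⟩) hβ hγ
    ⟨fun ξ => ⟨⟨c + (ξ.1 - b), key hb hc ξ.1⟩, show c ≤ c + (ξ.1.1 - b) from le_self_add⟩,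
      fun ξ => ⟨⟨b + (ξ.1 - c), key hc hb ξ.1⟩, show b ≤ b + (ξ.1.1 - c) from le_self_add⟩,
      fun ξ => ?_, fun ξ => ?_⟩
    (fun a => ⟨⟨c + (a - b), key hb hc a⟩, fun ξ h => ?_⟩)
    (fun a => ⟨⟨b + (a - c), key hc hb a⟩, fun ξ h => ?_⟩)
  · refine Subtype.ext (Subtype.ext ?_)
    have : b ≤ ξ.1.1 := ξ.2
    simp [Ordinal.add_sub_cancel_of_le this]
  · refine Subtype.ext (Subtype.ext ?_)
    have : c ≤ ξ.1.1 := ξ.2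
    simp [Ordinal.add_sub_cancel_of_le this]
  · exact (add_le_add_iff_left c).2 (sub_mono b h)
  · exact (add_le_add_iff_left b).2 (sub_mono c h)

/-! ### Block decompositions for successor tails. -/

/-- An ordinal closed under adding `c.ord` whose tails have order type at most `(succ c).ord` has
a final segment decomposed into `β.cof` many bounded blocks of size `c`. -/
theorem exists_blocks {c : Cardinal.{u}} (hc : ℵ₀ ≤ c)
    (h : ∃ b < β, β ≤ b + (Order.succ c).ord) (hadd : ∀ b < β, b + c.ord < β) :
    ∃ (b : Iio β) (T : Set (Iio β)) (g : Ici b → T),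
      Ordinal.type (α := T) (· < ·) = (Cardinal.lift.{u + 1} β.cof).ord ∧
      (∀ a, ∃ t, ∀ ξ, ξ.1 ≤ a → g ξ ≤ t) ∧ (∀ t, ∃ a, ∀ ξ, g ξ ≤ t → ξ.1 ≤ a) ∧
      ∀ t, #{ξ // g ξ = t} = Cardinal.lift.{u + 1} c := by
  obtain ⟨b, hb, hβ⟩ := h
  have hc0 : c.ord ≠ 0 := (isSuccLimit_ord hc).ne_bot
  let S : Set (Iio β) := {s | b ≤ s.1 ∧ c.ord ∣ s.1}
  have hS : IsCofinal S := by
    intro d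
    set m := max d.1 b
    have hm : m < β := max_lt d.2 hb
    have h1 : m ≤ c.ord * (m / c.ord) + c.ord := (Ordinal.lt_mul_div_add m hc0).le
    -- The first multiple of `c.ord` above `m`, which `hadd` keeps below `β`.
    refine ⟨⟨c.ord * (m / c.ord) + c.ord, ?_⟩, ⟨?_, ?_⟩, ?_⟩
    · exact (add_le_add_left (Ordinal.mul_div_le _ _) _).trans_lt (hadd m hm)
    · exact (le_max_right _ _).trans h1
    · exact (dvd_mul_right _ _).add dvd_rfl
    · exact (le_max_left d.1 b).trans h1
  have hsep : ∀ s ∈ S, ∀ s' ∈ S, s < s' → s.1 + c.ord ≤ s'.1 := by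
    rintro ⟨_, _⟩ ⟨_, p, rfl⟩ ⟨_, _⟩ ⟨_, q, rfl⟩ hlt
    have hpq : p < q := (mul_lt_mul_iff_right₀ (pos_iff_ne_zero.2 hc0)).1 hlt
    change c.ord * p + c.ord ≤ c.ord * q
    rw [← mul_add_one]
    exact mul_le_mul_right (Order.add_one_le_of_lt hpq) _
  obtain ⟨T, hTS, hT, htype⟩ := Ordinal.exists_ord_cof_eq_of_isCofinal hS
  rw [Ordinal.cof_Iio, ← Ordinal.lift_cof] at htype
  have hne : ∀ ξ : Ici (⟨b, hb⟩ : Iio β), {t : T | ξ.1.1 < t.1.1 + c.ord}.Nonempty := fun ξ => by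
    obtain ⟨t, ht, hle⟩ := hT ξ.1
    have : ξ.1.1 ≤ t.1 := hle
    exact ⟨⟨t, ht⟩, this.trans_lt (by simpa using pos_iff_ne_zero.2 hc0)⟩
  -- The fibre over `t` is `[t, t + c.ord)` together with the gap preceding it; it contains all of
  -- `[t, t + c.ord)` because elements of `T` are at least `c.ord` apart.
  let g : Ici (⟨b, hb⟩ : Iio β) → T := fun ξ => wellFounded_lt.min _ (hne ξ)
  have hg : ∀ ξ, ξ.1.1 < (g ξ).1.1 + c.ord := fun ξ => wellFounded_lt.min_mem _ (hne ξ)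
  have hg' : ∀ ξ t, ξ.1.1 < t.1.1 + c.ord → g ξ ≤ t := fun ξ t ht =>
    not_lt.1 (wellFounded_lt.not_lt_min {t : T | ξ.1.1 < t.1.1 + c.ord} ht)
  refine ⟨⟨b, hb⟩, T, g, htype, fun a => ?_, fun t => ?_, fun t => le_antisymm ?_ ?_⟩
  · obtain ⟨t, ht, hat⟩ := hT a
    exact ⟨⟨t, ht⟩, fun ξ h => hg' _ _ <|
      (show ξ.1.1 ≤ t from h.trans hat).trans_lt (by simpa using pos_iff_ne_zero.2 hc0)⟩
  · refine ⟨⟨t.1.1 + c.ord, hadd _ t.1.2⟩, fun ξ h => (hg ξ).le.trans ?_⟩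
    exact add_le_add_left (show (g ξ).1.1 ≤ t.1.1 from h) _
  · have hsub : t.1.1 + c.ord - b < (Order.succ c).ord :=
      Ordinal.sub_lt_of_lt_add ((hadd _ t.1.2).trans_le hβ)
        (isSuccLimit_ord (hc.trans (Order.le_succ c))).bot_lt
    let f : {ξ // g ξ = t} → Iio (t.1.1 + c.ord - b) := fun ξ => ⟨ξ.1.1.1 - b, by
      rw [mem_Iio, Ordinal.lt_sub, Ordinal.add_sub_cancel_of_le (show b ≤ ξ.1.1.1 from ξ.1.2)]
      exact (hg ξ.1).trans_eq (by rw [ξ.2])⟩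
    have hf : Function.Injective f := fun ξ η h => by
      have h1 : ξ.1.1.1 - b = η.1.1.1 - b := congrArg Subtype.val h
      have h2 := Ordinal.add_sub_cancel_of_le (show b ≤ ξ.1.1.1 from ξ.1.2)
      rw [h1, Ordinal.add_sub_cancel_of_le (show b ≤ η.1.1.1 from η.1.2)] at h2
      exact Subtype.ext (Subtype.ext (Subtype.ext h2.symm))
    refine (mk_le_of_injective hf).trans ?_
    rw [mk_Iio_ordinal, lift_le]
    exact card_le_iff.2 hsub
  · have hmem : ∀ r : Iio c.ord, t.1.1 + r < β := fun r =>
      ((add_lt_add_iff_left _).2 r.2).trans (hadd _ t.1.2)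
    let f : Iio c.ord → {ξ // g ξ = t} := fun r =>
      ⟨⟨⟨t.1.1 + r, hmem r⟩, (hTS t.2).1.trans le_self_add⟩, by
        refine le_antisymm (hg' _ _ ((add_lt_add_iff_left _).2 r.2)) (not_lt.1 fun hlt => ?_)
        have h1 := hsep _ (hTS (g _).2) _ (hTS t.2) hlt
        exact ((hg _).trans_le h1).not_ge le_self_add⟩
    have hf : Function.Injective f := fun r s h => by
      have h1 : t.1.1 + r.1 = t.1.1 + s.1 := congrArg (fun z => z.1.1.1) h
      exact Subtype.ext (add_left_cancel h1)
    simpa using mk_le_of_injective hf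

theorem coarselyEquivalent_of_blocks (hβ : β ≠ 0) (hγ : γ ≠ 0) (hcof : β.cof = γ.cof)
    {c : Cardinal.{u}} (hc : ℵ₀ ≤ c)
    (hb : ∃ b < β, β ≤ b + (Order.succ c).ord) (hb' : ∀ b < β, b + c.ord < β)
    (hg : ∃ b < γ, γ ≤ b + (Order.succ c).ord) (hg' : ∀ b < γ, b + c.ord < γ) :
    Ballean.CoarselyEquivalent (cantorMacroCube β hβ) (cantorMacroCube γ hγ) := by
  obtain ⟨b, T, g, hT, h1, h2, h3⟩ := exists_blocks hc hb hb'
  obtain ⟨b', T', g', hT', h1', h2', h3'⟩ := exists_blocks hc hg hg'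
  rw [hcof, ← hT'] at hT
  obtain ⟨r⟩ := Ordinal.type_eq.1 hT
  let o : T ≃o T' := OrderIso.ofRelIsoLT r
  have hfib : ∀ t', Nonempty ({ξ // o (g ξ) = t'} ≃ {ξ // g' ξ = t'}) := fun t' => by
    rw [← Cardinal.eq, h3', ← h3 (o.symm t')]
    exact mk_congr (Equiv.subtypeEquivRight fun ξ => by rw [OrderIso.eq_symm_apply])
  let e : Ici b ≃ Ici b' := Equiv.ofFiberEquiv (f := fun ξ => o (g ξ)) fun t' => (hfib t').some
  have he : ∀ ξ, g' (e ξ) = o (g ξ) := Equiv.ofFiberEquiv_map _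
  refine coarselyEquivalent_of_equiv hβ hγ e (fun a => ?_) (fun a => ?_)
  · obtain ⟨t, ht⟩ := h1 a
    obtain ⟨a', ha'⟩ := h2' (o t)
    exact ⟨a', fun ξ h => ha' _ (by rw [he]; exact o.le_iff_le.2 (ht ξ h))⟩
  · obtain ⟨t, ht⟩ := h1' a
    obtain ⟨a', ha'⟩ := h2 (o.symm t)
    refine ⟨a', fun ξ h => ha' _ ?_⟩
    rw [o.le_symm_apply, ← he, e.apply_symm_apply]
    exact ht ξ h

end MacroCube

/-! ### Arithmetic of the cardinal tail. -/

section CardinalTail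

variable {β γ : Ordinal.{u}}

theorem exists_cardinalTail_eq_ord (hβ : β ≠ 0) :
    ∃ k : Cardinal.{u}, cardinalTail β = k.ord ∧ (∃ b < β, β ≤ b + k.ord) ∧
      ∀ k' < k, ∀ b < β, b + k'.ord < β := by
  set A := {α : Ordinal.{u} | ∃ b < β, β ≤ b + α.card.ord}
  have hA : A.Nonempty := by
    refine ⟨(Order.succ β.card).ord, 0, pos_iff_ne_zero.2 hβ, ?_⟩
    rw [card_ord, zero_add]
    exact (lt_ord_succ_card β).le
  have hmem : cardinalTail β ∈ A := csInf_mem hA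
  have hle : ∀ k : Cardinal.{u}, (∃ b < β, β ≤ b + k.ord) → cardinalTail β ≤ k.ord := fun k h =>
    csInf_le' (show k.ord ∈ A by rwa [← card_ord k] at h)
  refine ⟨(cardinalTail β).card, le_antisymm (hle _ hmem) (ord_card_le _), hmem, ?_⟩
  intro k' hk' b hb
  by_contra! hlt
  have := (ord_card_le _).trans (hle k' ⟨b, hb, hlt⟩)
  exact hk'.not_ge (ord_le_ord.1 this)

/-- If `β = b + δ` with `0 < δ < k.ord`, minimality gives `k = succ δ.card`. A finite `δ` would make
`β` a successor with `1 < k`, against minimality. -/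
theorem eq_add_ord_or_eq_succ {k : Cardinal.{u}} (h : ∃ b < β, β ≤ b + k.ord)
    (hk : ∀ k' < k, ∀ b < β, b + k'.ord < β) :
    (∃ b, β = b + k.ord) ∨ ∃ c, ℵ₀ ≤ c ∧ k = Order.succ c := by
  obtain ⟨b, hb, hle⟩ := h
  rw [or_iff_not_imp_left]
  intro hne
  have hlt : β < b + k.ord := hle.lt_of_ne fun h => hne ⟨b, h⟩
  have hδ : β - b < k.ord := (Ordinal.sub_lt_of_le hb.le).2 hlt
  have hβ : b + (β - b) = β := Ordinal.add_sub_cancel_of_le hb.le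
  have hpos : β - b ≠ 0 := fun h => by
    rw [h, add_zero] at hβ
    exact hb.ne hβ
  refine ⟨(β - b).card, ?_, ?_⟩
  · by_contra! hfin
    rw [← not_le, Ordinal.aleph0_le_card, not_le] at hfin
    obtain ⟨n, hn⟩ := Ordinal.lt_omega0.1 hfin
    obtain _ | n := n
    · exact hpos (by simpa using hn)
    · have h1 : (1 : Cardinal.{u}) < k := by
        refine lt_of_le_of_lt ?_ (lt_ord.1 hδ)
        rw [hn, Ordinal.card_nat]
        exact_mod_cast Nat.succ_pos n
      have h2 : b + n + 1 = β := by rw [← hβ, hn, add_assoc]; norm_cast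
      have h3 := hk 1 h1 (b + n) (by rw [← h2]; exact Order.lt_add_one_iff.2 le_rfl)
      rw [ord_one, h2] at h3
      exact h3.false
  · refine le_antisymm (not_lt.1 fun h => ?_) (Order.succ_le_of_lt (lt_ord.1 hδ))
    have h1 := hk _ h b hb
    exact ((Ordinal.lt_sub).2 h1).not_ge (lt_ord_succ_card _).le

/-- Counting finite subsets is too crude for finite `k`. Instead, a finite tail bound makes `β` a
successor, which cofinality detects. -/
theorem exists_le_add_ord_of_cof_eq {k : Cardinal.{u}} (hk : k < ℵ₀) (hγ : γ ≠ 0)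
    (hcof : γ.cof ≤ β.cof) (h : ∃ b < β, β ≤ b + k.ord) : ∃ c < γ, γ ≤ c + k.ord := by
  obtain ⟨b, hb, hle⟩ := h
  obtain ⟨n, rfl⟩ := lt_aleph0.1 hk
  rw [ord_natCast] at hle ⊢
  obtain ⟨m, hm⟩ := Ordinal.lt_omega0.1
    ((Ordinal.sub_le.2 hle).trans_lt (Ordinal.natCast_lt_omega0 n))
  have hβ : b + (β - b) = β := Ordinal.add_sub_cancel_of_le hb.le
  rw [hm] at hβ
  obtain _ | m := m
  · simp only [Nat.cast_zero, add_zero] at hβ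
    exact absurd hβ hb.ne
  have h1 : β.cof = 1 := by
    rw [← hβ, Nat.cast_succ, ← add_assoc, Ordinal.cof_add_one]
  have h2 : γ.cof = 1 := le_antisymm (hcof.trans_eq h1) (by simpa [Cardinal.one_le_iff_ne_zero])
  obtain ⟨c, rfl⟩ := Ordinal.cof_eq_one_iff.1 h2
  refine ⟨c, Order.lt_succ c, ?_⟩
  obtain _ | n := n
  · simp only [Nat.cast_zero, add_zero] at hle
    exact absurd hle hb.not_ge
  · rw [Order.succ_eq_add_one, add_le_add_iff_left]
    exact_mod_cast Nat.succ_pos n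

end CardinalTail

open MacroCube in
theorem cof_le_and_exists_le_add_ord {β γ : Ordinal.{u}} {hβ : β ≠ 0} {hγ : γ ≠ 0}
    (h : Ballean.CoarselyEquivalent (cantorMacroCube β hβ) (cantorMacroCube γ hγ)) :
    γ.cof ≤ β.cof ∧
      ∀ k : Cardinal.{u}, (∃ b < β, β ≤ b + k.ord) → ∃ b < γ, γ ≤ b + k.ord := by
  obtain ⟨F, hF⟩ := exists_isCoarseEquiv h
  refine ⟨hF.cof_le, fun k hk => ?_⟩
  obtain hfin | hinf := lt_or_ge k ℵ₀
  · exact exists_le_add_ord_of_cof_eq hfin hγ hF.cof_le hk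
  · exact hF.exists_le_add_ord hinf hk

theorem Ballean.CoarselyEquivalent.symm {X : Type u} {Y : Type v} {E : Ballean X} {F : Ballean Y}
    (h : E.CoarselyEquivalent F) : F.CoarselyEquivalent E := by
  obtain ⟨L, M, hL, hM, f, hf, hf'⟩ := h
  exact ⟨M, L, hM, hL, f.symm, hf', hf⟩

theorem mainTheorem7 (β γ : Ordinal.{u}) (hβ : β ≠ 0) (hγ : γ ≠ 0) :
    Ballean.CoarselyEquivalent (cantorMacroCube β hβ) (cantorMacroCube γ hγ) ↔
      β.cof = γ.cof ∧ cardinalTail β = cardinalTail γ := by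
  constructor
  · intro h
    obtain ⟨h1, h2⟩ := cof_le_and_exists_le_add_ord h
    obtain ⟨h1', h2'⟩ := cof_le_and_exists_le_add_ord h.symm
    exact ⟨h1'.antisymm h1, congrArg sInf (Set.ext fun α => ⟨h2 α.card, h2' α.card⟩)⟩
  · rintro ⟨hcof, htail⟩
    obtain ⟨k, hk, hb, hmin⟩ := exists_cardinalTail_eq_ord hβ
    obtain ⟨k', hk', hb', hmin'⟩ := exists_cardinalTail_eq_ord hγ
    obtain rfl : k = k' := ord_injective (hk.symm.trans (htail.trans hk'))
    -- Splitting on `k` alone puts both ordinals in the same case.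
    by_cases hsucc : ∃ c, ℵ₀ ≤ c ∧ k = Order.succ c
    · obtain ⟨c, hc, rfl⟩ := hsucc
      exact MacroCube.coarselyEquivalent_of_blocks hβ hγ hcof hc hb
        (hmin c (Order.lt_succ c)) hb' (hmin' c (Order.lt_succ c))
    · obtain ⟨b, h⟩ := (eq_add_ord_or_eq_succ hb hmin).resolve_right hsucc
      obtain ⟨c, h'⟩ := (eq_add_ord_or_eq_succ hb' hmin').resolve_right hsucc
      refine MacroCube.coarselyEquivalent_of_eq_add hβ hγ (fun h0 => ?_) h h'
      obtain ⟨d, hd, hle⟩ := hb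
      rw [h0, add_zero] at hle
      exact hle.not_gt hd
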